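/- Let $R$ be $\mathbb{Z}$ or a countable field. All chain complexes are $\mathbb{Z}$-graded (unbounded) complexes of $R$-modules, and signs follow the Koszul convention. Let $\mathcal{V}=\{\mathcal{V}(n)\}_{n\ge 0}$ be a symmetric operad in chain complexes (with unit in $\mathcal{V}(1)$ and structure maps $\mathcal{V}(n)\otimes\mathcal{V}(k_1)\otimes\cdots\otimes\mathcal{V}(k_n)\to\mathcal{V}(k_1+\cdots+k_n)$) such that 1. there is a morphism of operads $\delta:\mathcal{V}\to\mathcal{V}\otimes\mathfrak{S}$, where $\mathfrak{S}$ is the Barratt–Eccles operad over $R$ ($\mathfrak{S}(n)$ is the normalized chain complex of the universal cover of $K(S_n,1)$) and $\otimes$ is the aritywise tensor product of operads, whose composite with the projection $1\otimes\epsilon:\mathcal{V}\otimes\mathfrak{S}\to\mathcal{V}$ given by the augmentations $\epsilon_n:\mathfrak{S}(n)\to R$ is the identity of $\mathcal{V}$; 2. each $\mathcal{V}(n)$ is $RS_n$-projective (the underlying graded module, in each degree) and of finite type, i.e. finitely generated in each degree; 3. $\mathcal{V}(1)=R$, generated by the unit of the operad. A $\mathcal{V}$-coalgebra is a chain complex $C$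 with a morphism of operads $\mathcal{V}\to\mathrm{CoEnd}(C)$, where $\mathrm{CoEnd}(C)(n)=\mathrm{Hom}_R(C,C^{\otimes n})$. A morphism of $\mathcal{V}$-coalgebras is a chain map of degree $0$ that commutes with all the structure maps $C\to C^{\otimes n}$ given by elements of $\mathcal{V}(n)$. A sub-coalgebra of $C$ is a subcomplex with a $\mathcal{V}$-coalgebra structure for which the inclusion into $C$ is a morphism of $\mathcal{V}$-coalgebras. An $R$-module is nearly free if each of its countable submodules is free. Let $C$ be a $\mathcal{V}$-coalgebra whose underlying module is nearly free, and let $\{C_\alpha\}$ be the family of all countable sub-coalgebras of $C$, ordered by inclusion. Then $$C=\varinjlim C_\alpha .$$ Explicitly: the family $\{C_\alpha\}$ is directed, and every inclusion $C_\alpha\subseteq C_\beta$ is a morphism of $\mathcal{V}$-coalgebras; every element of $C$ lies in some $C_\alpha$; and for every $\mathcal{V}$-coalgebra $D$, every family of coalgebra morphisms $\varphi_\alpha:C_\alpha\to D$ compatible with the inclusions is induced by exactly one coalgebra morphism $\psi:C\to D$. -/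

import Mathlib

open scoped TensorProduct

universe u v w u'

namespace DGOperad

/-! ### Multilinear preliminaries -/

section Multilinear

variable {R : Type u} [CommRing R]

theorem exists_pairing {E : Type u'} [AddCommGroup E] [Module R E] :
    ∀ (n : ℕ) (A : Fin n → Type v) (B : Fin n → Type w)
      [∀ i, AddCommGroup (A i)] [∀ i, Module R (A i)]
      [∀ i, AddCommGroup (B i)] [∀ i, Module R (B i)],
      ∃ L : MultilinearMap R A (MultilinearMap R B E) →ₗ[R]
          MultilinearMap R (fun i => A i ⊗[R] B i) E,
        ∀ Φ a b, L Φ (fun i => a i ⊗ₜ[R] b i) = Φ a b := by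
  intro n
  induction n with
  | zero =>
    intro A B _ _ _ _
    refine ⟨{ toFun := fun Φ => MultilinearMap.constOfIsEmpty R _ (Φ (fun i => i.elim0) (fun i => i.elim0))
              map_add' := ?_, map_smul' := ?_ }, ?_⟩
    · intro x y; ext; simp
    · intro x y; ext; simp
    · intro Φ a b
      have ha : a = fun i => i.elim0 := Subsingleton.elim _ _
      have hb : b = fun i => i.elim0 := Subsingleton.elim _ _
      subst ha; subst hb; rfl
  | succ n ih =>
    intro A B _ _ _ _
    obtain ⟨L, hL⟩ := ih (fun i => A i.succ) (fun i => B i.succ)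
    let cB := (multilinearCurryLeftEquiv R B E).toLinearMap
    let cA := (multilinearCurryLeftEquiv R A (MultilinearMap R B E)).toLinearMap
    let step : MultilinearMap R A (MultilinearMap R B E) →ₗ[R] A 0 →ₗ[R] B 0 →ₗ[R]
        MultilinearMap R (fun i : Fin n => A i.succ ⊗[R] B i.succ) E :=
      { toFun := fun Φ => LinearMap.mk₂ R
          (fun a b => L (((LinearMap.applyₗ b) ∘ₗ cB).compMultilinearMap (cA Φ a)))
          (by intro a a' b; rw [← map_add]; congr 1; ext; simp)
          (by intro c a b; rw [← map_smul]; congr 1; ext; simp)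
          (by intro a b b'; rw [← map_add]; congr 1; ext; simp)
          (by intro c a b; rw [← map_smul]; congr 1; ext; simp)
        map_add' := by
          intro Φ Ψ; refine LinearMap.ext₂ fun a b => ?_
          simp only [LinearMap.mk₂_apply, LinearMap.add_apply]
          rw [← map_add]; congr 1
        map_smul' := by
          intro c Φ; refine LinearMap.ext₂ fun a b => ?_
          simp only [LinearMap.mk₂_apply, LinearMap.smul_apply, RingHom.id_apply]
          rw [← map_smul]; congr 1 }
    refine ⟨(multilinearCurryLeftEquiv R (fun i => A i ⊗[R] B i) E).symm.toLinearMap ∘ₗ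
      (TensorProduct.lift.equiv (RingHom.id R) (A 0) (B 0) _).toLinearMap ∘ₗ step, ?_⟩
    intro Φ a b
    simp [step, multilinearCurryLeftEquiv]
    have := hL (((LinearMap.applyₗ (b 0)) ∘ₗ cB).compMultilinearMap (cA Φ (a 0)))
      (Fin.tail a) (Fin.tail b)
    erw [this]
    simp [cA, cB]

theorem exists_flattening {M : Type v} [AddCommGroup M] [Module R M]
    {E : Type w} [AddCommGroup E] [Module R E] :
    ∀ (n : ℕ) (k : Fin n → ℕ),
      ∃ L : MultilinearMap R (fun _ : (i : Fin n) × Fin (k i) => M) E →ₗ[R]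
          MultilinearMap R (fun i : Fin n => ⨂[R] _ : Fin (k i), M) E,
        ∀ Φ (x : ∀ i, Fin (k i) → M),
          L Φ (fun i => PiTensorProduct.tprod R (x i)) = Φ (fun s => x s.1 s.2) := by
  intro n
  induction n with
  | zero =>
    intro k
    refine ⟨{ toFun := fun Φ => MultilinearMap.constOfIsEmpty R _ (Φ (fun _ => 0))
              map_add' := ?_, map_smul' := ?_ }, ?_⟩
    · intro x y; ext; simp
    · intro x y; ext; simp
    · intro Φ a
      exact congrArg Φ (funext fun s => s.1.elim0)
  | succ n ih =>
    intro k
    obtain ⟨L, hL⟩ := ih (fun i => k i.succ)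
    let e : ((i : Fin (n + 1)) × Fin (k i)) ≃
        Fin (k 0) ⊕ ((i : Fin n) × Fin (k i.succ)) :=
      { toFun := fun s => Fin.cases (motive := fun i => Fin (k i) → Fin (k 0) ⊕ ((i : Fin n) × Fin (k i.succ))) (fun j => Sum.inl j) (fun i j => Sum.inr ⟨i, j⟩) s.1 s.2
        invFun := Sum.elim (fun j => ⟨0, j⟩) (fun s => ⟨s.1.succ, s.2⟩)
        left_inv := by
          rintro ⟨i, j⟩
          induction i using Fin.cases <;> rfl
        right_inv := by rintro (j | ⟨i, j⟩) <;> rfl }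
    let c : MultilinearMap R (fun _ : (i : Fin (n + 1)) × Fin (k i) => M) E →ₗ[R]
        MultilinearMap R (fun _ : Fin (k 0) => M)
          (MultilinearMap R (fun _ : (i : Fin n) × Fin (k i.succ) => M) E) :=
      (MultilinearMap.currySumEquiv (R := R) (N := fun _ => M) (M₂ := E)).toLinearMap ∘ₗ
        (MultilinearMap.domDomCongrLinearEquiv R R M E e).toLinearMap
    let st : MultilinearMap R (fun _ : Fin (k 0) => M)
          (MultilinearMap R (fun _ : (i : Fin n) × Fin (k i.succ) => M) E) →ₗ[R]
        MultilinearMap R (fun _ : Fin (k 0) => M)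
          (MultilinearMap R (fun i : Fin n => ⨂[R] _ : Fin (k i.succ), M) E) :=
      { toFun := fun Ψ => L.compMultilinearMap Ψ
        map_add' := by intro x y; ext; simp
        map_smul' := by intro x y; ext; simp }
    refine ⟨(multilinearCurryLeftEquiv R (fun i : Fin (n+1) => ⨂[R] _ : Fin (k i), M) E).symm.toLinearMap ∘ₗ
      (PiTensorProduct.lift (R := R)).toLinearMap ∘ₗ st ∘ₗ c, ?_⟩
    intro Φ x
    simp [multilinearCurryLeftEquiv]
    have := hL (c Φ (x 0)) (fun i => x i.succ)
    simp only [st, LinearMap.coe_mk, AddHom.coe_mk]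
    refine Eq.trans ?_ (this.trans ?_)
    · rfl
    · change Φ _ = Φ _
      congr 1; funext ⟨i, j⟩
      induction i using Fin.cases <;> rfl

/-- The multilinear rearrangement map `∏ᵢ (Aᵢ ⊗ Bᵢ) → (⨂ᵢ Aᵢ) ⊗ (⨂ᵢ Bᵢ)` (without signs): the
unique multilinear map with `(aᵢ ⊗ bᵢ)ᵢ ↦ (⨂ᵢ aᵢ) ⊗ (⨂ᵢ bᵢ)`; see `interchange_tmul`. -/
noncomputable def interchange {n : ℕ} (A : Fin n → Type v) (B : Fin n → Type w)
    [∀ i, AddCommGroup (A i)] [∀ i, Module R (A i)]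
    [∀ i, AddCommGroup (B i)] [∀ i, Module R (B i)] :
    MultilinearMap R (fun i => A i ⊗[R] B i) ((⨂[R] i, A i) ⊗[R] (⨂[R] i, B i)) :=
  (exists_pairing (R := R) (E := (⨂[R] i, A i) ⊗[R] (⨂[R] i, B i)) n A B).choose
    { toFun := fun a => (TensorProduct.mk R _ _ (PiTensorProduct.tprod R a)).compMultilinearMap
        (PiTensorProduct.tprod R)
      map_update_add' := by intro _ a i x y; ext b; simp
      map_update_smul' := by intro _ a i c x; ext b; simp [TensorProduct.smul_tmul'] }

theorem interchange_tmul {n : ℕ} (A : Fin n → Type v) (B : Fin n → Type w)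
    [∀ i, AddCommGroup (A i)] [∀ i, Module R (A i)]
    [∀ i, AddCommGroup (B i)] [∀ i, Module R (B i)] (a : ∀ i, A i) (b : ∀ i, B i) :
    interchange (R := R) A B (fun i => a i ⊗ₜ[R] b i) =
      PiTensorProduct.tprod R a ⊗ₜ[R] PiTensorProduct.tprod R b :=
  (exists_pairing (R := R) (E := (⨂[R] i, A i) ⊗[R] (⨂[R] i, B i)) n A B).choose_spec _ a b

/-- The concatenation map `M^{⊗k₁} ⊗ ⋯ ⊗ M^{⊗kₙ} → M^{⊗(k₁+⋯+kₙ)}`, see `flatten_tprod`. -/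
noncomputable def flatten (M : Type v) [AddCommGroup M] [Module R M] {n : ℕ} (k : Fin n → ℕ) :
    (⨂[R] i : Fin n, ⨂[R] _ : Fin (k i), M) →ₗ[R] (⨂[R] _ : Fin (∑ i, k i), M) :=
  PiTensorProduct.lift
    ((exists_flattening (R := R) (M := M) (E := ⨂[R] _ : Fin (∑ i, k i), M) n k).choose
      ((PiTensorProduct.tprod R).domDomCongr finSigmaFinEquiv.symm))

theorem flatten_tprod (M : Type v) [AddCommGroup M] [Module R M] {n : ℕ} (k : Fin n → ℕ)
    (x : ∀ i, Fin (k i) → M) :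
    flatten (R := R) M k (PiTensorProduct.tprod R fun i => PiTensorProduct.tprod R (x i)) =
      PiTensorProduct.tprod R
        (fun l => x (finSigmaFinEquiv.symm l).1 (finSigmaFinEquiv.symm l).2) := by
  rw [flatten, PiTensorProduct.lift.tprod,
    (exists_flattening (R := R) (M := M) (E := ⨂[R] _ : Fin (∑ i, k i), M) n k).choose_spec]
  rfl

end Multilinear

/-! ### Differential graded modules -/

section Graded

variable {R : Type u} [CommRing R] {M : Type v} [AddCommGroup M] [Module R M]

/-- The projection of a `ℤ`-graded module onto the sum of its components of degree congruent to
`e` modulo 2. -/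
noncomputable def parityProj {gr : ℤ → Submodule R M} (h : DirectSum.IsInternal gr) (e : Fin 2) :
    M →ₗ[R] M :=
  (DirectSum.toModule R ℤ M
      (fun k => if k % 2 = ((e : ℕ) : ℤ) then (gr k).subtype else 0)) ∘ₗ
    (LinearEquiv.ofBijective (DirectSum.coeLinearMap gr) h).symm.toLinearMap

/-- The sign involution of a `ℤ`-graded module, `x ↦ (-1) ^ deg x • x`. -/
noncomputable def signInv {gr : ℤ → Submodule R M} (h : DirectSum.IsInternal gr) : M →ₗ[R] M :=
  parityProj h 0 - parityProj h 1

end Graded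

/-- An (unbounded) chain complex of `R`-modules, given by its underlying module (the direct sum of
all components), the grading and the differential of degree `-1`. -/
structure DGModule (R : Type u) [CommRing R] where
  carrier : Type v
  [addCommGroup : AddCommGroup carrier]
  [module : Module R carrier]
  gr : ℤ → Submodule R carrier
  internal : DirectSum.IsInternal gr
  d : carrier →ₗ[R] carrier
  d_mem : ∀ k, ∀ x ∈ gr k, d x ∈ gr (k - 1)
  d_d : ∀ x, d (d x) = 0

attribute [instance] DGModule.addCommGroup DGModule.module

/-- The sign exponent of a permutation of graded factors: factor `i`, of degree `q i`, is moved to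
position `e i`, and each pair of factors whose order is reversed contributes the product of its
degrees. -/
def permSign {a b : ℕ} (e : Fin a ≃ Fin b) (q : Fin a → ℤ) : ℤˣ :=
  (∑ i, ∑ j, if i < j ∧ e j < e i then q i * q j else 0).negOnePow

/-- The parity of an index of `parityProj` as an integer. -/
def par {n : ℕ} (ε : Fin n → Fin 2) (i : Fin n) : ℤ := ((ε i : ℕ) : ℤ)

namespace DGModule

variable {R : Type u} [CommRing R] (C : DGModule.{u, v} R)

/-- The underlying module of the `n`-fold tensor power `C ⊗ ⋯ ⊗ C`. -/
abbrev Pow (n : ℕ) : Type (max u v) := ⨂[R] _ : Fin n, C.carrier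

/-- The degree `m` part of the tensor power. -/
def powGr (n : ℕ) (m : ℤ) : Submodule R (C.Pow n) :=
  Submodule.span R
    {t | ∃ (x : Fin n → C.carrier) (q : Fin n → ℤ),
      (∀ i, x i ∈ C.gr (q i)) ∧ ∑ i, q i = m ∧ t = PiTensorProduct.tprod R x}

/-- The sign involution `t ↦ (-1) ^ deg t • t` of the tensor power. -/
noncomputable def powSign (n : ℕ) : C.Pow n →ₗ[R] C.Pow n :=
  PiTensorProduct.map fun _ => signInv C.internal

/-- The differential of the tensor power, with Koszul signs:
`d (x₁ ⊗ ⋯ ⊗ xₙ) = ∑ᵢ (-1) ^ (deg x₁ + ⋯ + deg xᵢ₋₁) x₁ ⊗ ⋯ ⊗ d xᵢ ⊗ ⋯ ⊗ xₙ`. -/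
noncomputable def powD (n : ℕ) : C.Pow n →ₗ[R] C.Pow n :=
  ∑ i : Fin n, PiTensorProduct.map fun j =>
    if j < i then signInv C.internal else if j = i then C.d else LinearMap.id

/-- The projection of the tensor power onto the part of parity `e`. -/
noncomputable def powParity (n : ℕ) (e : Fin 2) : C.Pow n →ₗ[R] C.Pow n :=
  ∑ ε : Fin n → Fin 2, if (∑ i, par ε i) % 2 = ((e : ℕ) : ℤ) then
    PiTensorProduct.map (fun i => parityProj C.internal (ε i)) else 0

/-- The permutation of tensor factors that moves factor `i` to position `e i`, with Koszul
signs. -/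
noncomputable def powPerm {a b : ℕ} (e : Fin a ≃ Fin b) : C.Pow a →ₗ[R] C.Pow b :=
  ∑ ε : Fin a → Fin 2, permSign e (par ε) •
    ((PiTensorProduct.reindex R (fun _ => C.carrier) e).toLinearMap ∘ₗ
      PiTensorProduct.map (fun i => parityProj C.internal (ε i)))

end DGModule

/-! ### Operads -/

section Blocks

/-- The permutation of blocks induced by `e`: the block of `k (e i)` letters in position `i` is
moved to position `e i`, without changing the order inside the block. -/
def blockEquiv {a b : ℕ} (e : Fin a ≃ Fin b) (k : Fin b → ℕ) :
    Fin (∑ i, k (e i)) ≃ Fin (∑ i, k i) :=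
  finSigmaFinEquiv.symm.trans
    ((Equiv.sigmaCongrLeft (β := fun i => Fin (k i)) e).trans finSigmaFinEquiv)

/-- The block sum of bijections. -/
def sumEquiv {n : ℕ} {k l : Fin n → ℕ} (e : ∀ i, Fin (k i) ≃ Fin (l i)) :
    Fin (∑ i, k i) ≃ Fin (∑ i, l i) :=
  finSigmaFinEquiv.symm.trans ((Equiv.sigmaCongrRight e).trans finSigmaFinEquiv)

/-- The sizes `m` of the inner blocks of the `i`-th outer block. -/
def innerArity {n : ℕ} {k : Fin n → ℕ} (m : Fin (∑ i, k i) → ℕ) (i : Fin n) (j : Fin (k i)) : ℕ :=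
  m (finSigmaFinEquiv ⟨i, j⟩)

theorem sum_innerArity {n : ℕ} {k : Fin n → ℕ} (m : Fin (∑ i, k i) → ℕ) :
    ∑ l, m l = ∑ i, ∑ j, innerArity m i j := by
  rw [← finSigmaFinEquiv.sum_comp, Fintype.sum_sigma]
  rfl

theorem sum_fin_one (n : ℕ) : ∑ _i : Fin 1, n = n := by simp

theorem sum_one (n : ℕ) : ∑ _i : Fin n, 1 = n := by simp

end Blocks

/-- The data of a (symmetric, differential graded) operad, without its laws.

`comp k` is the structure map `γ : V(n) ⊗ V(k₁) ⊗ ⋯ ⊗ V(kₙ) → V(k₁ + ⋯ + kₙ)`.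

A bijection `Fin a ≃ Fin b` exists only for `a = b`, so that `act` is nothing but the right action
of the symmetric group `Perm (Fin n)` on each `V(n)`; letting it accept all bijections
`Fin a ≃ Fin b` avoids transports along equalities of arities. -/
structure OperadData (R : Type u) [CommRing R] where
  obj : ℕ → Type v
  [addCommGroup : ∀ n, AddCommGroup (obj n)]
  [module : ∀ n, Module R (obj n)]
  gr : ∀ n, ℤ → Submodule R (obj n)
  d : ∀ n, obj n →ₗ[R] obj n
  act : ∀ {a b : ℕ}, (Fin a ≃ Fin b) → (obj b →ₗ[R] obj a)
  one : obj 1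
  comp : ∀ {n : ℕ} (k : Fin n → ℕ),
    obj n →ₗ[R] MultilinearMap R (fun i => obj (k i)) (obj (∑ i, k i))

attribute [instance] OperadData.addCommGroup OperadData.module

/-- A symmetric operad in unbounded chain complexes of `R`-modules: each `V(n)` is a chain complex
with an action of the symmetric group by chain maps, the unit is a cycle of degree 0, and the
compositions are chain maps of degree 0 that satisfy the unit, associativity and equivariance
laws, with the signs of the Koszul convention. -/
structure Operad (R : Type u) [CommRing R] extends OperadData.{u, v} R where
  internal : ∀ n, DirectSum.IsInternal (gr n)
  d_mem : ∀ n k, ∀ x ∈ gr n k, d n x ∈ gr n (k - 1)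
  d_d : ∀ n x, d n (d n x) = 0
  act_mem : ∀ {a b : ℕ} (e : Fin a ≃ Fin b) (k : ℤ), ∀ x ∈ gr b k, act e x ∈ gr a k
  act_d : ∀ {a b : ℕ} (e : Fin a ≃ Fin b) (x : obj b), act e (d b x) = d a (act e x)
  act_refl : ∀ {a : ℕ} (x : obj a), act (Equiv.refl (Fin a)) x = x
  act_trans : ∀ {a b c : ℕ} (e : Fin a ≃ Fin b) (f : Fin b ≃ Fin c) (x : obj c),
    act (e.trans f) x = act e (act f x)
  one_mem : one ∈ gr 1 0
  d_one : d 1 one = 0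
  comp_mem : ∀ {n : ℕ} (k : Fin n → ℕ) (p : ℤ) (q : Fin n → ℤ) (x : obj n) (y : ∀ i, obj (k i)),
    x ∈ gr n p → (∀ i, y i ∈ gr (k i) (q i)) → comp k x y ∈ gr (∑ i, k i) (p + ∑ i, q i)
  d_comp : ∀ {n : ℕ} (k : Fin n → ℕ) (p : ℤ) (q : Fin n → ℤ) (x : obj n) (y : ∀ i, obj (k i)),
    x ∈ gr n p → (∀ i, y i ∈ gr (k i) (q i)) →
    d _ (comp k x y) = comp k (d n x) y +
      ∑ i, (p + ∑ j, if j < i then q j else 0).negOnePow •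
        comp k x (Function.update y i (d (k i) (y i)))
  one_comp : ∀ {n : ℕ} (x : obj n),
    comp (fun _ : Fin 1 => n) one (fun _ => x) = act (finCongr (sum_fin_one n)) x
  comp_one : ∀ {n : ℕ} (x : obj n),
    comp (fun _ : Fin n => 1) x (fun _ => one) = act (finCongr (sum_one n)) x
  comp_comp : ∀ {n : ℕ} (k : Fin n → ℕ) (m : Fin (∑ i, k i) → ℕ)
    (q : Fin n → ℤ) (r : Fin (∑ i, k i) → ℤ)
    (x : obj n) (y : ∀ i, obj (k i)) (z : ∀ l, obj (m l)),
    (∀ i, y i ∈ gr (k i) (q i)) → (∀ l, z l ∈ gr (m l) (r l)) →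
    comp m (comp k x y) z =
      (∑ i, ∑ l, if (finSigmaFinEquiv.symm l).1 < i then q i * r l else 0).negOnePow •
        act (finCongr (sum_innerArity m))
          (comp (fun i => ∑ j, innerArity m i j) x
            (fun i => comp (innerArity m i) (y i) (fun j => z (finSigmaFinEquiv ⟨i, j⟩))))
  act_comp : ∀ {a b : ℕ} (e : Fin a ≃ Fin b) (k : Fin b → ℕ) (q : Fin b → ℤ)
    (x : obj b) (y : ∀ i, obj (k i)), (∀ i, y i ∈ gr (k i) (q i)) →
    comp (fun i => k (e i)) (act e x) (fun i => y (e i)) =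
      permSign e (fun i => q (e i)) • act (blockEquiv e k) (comp k x y)
  comp_act : ∀ {n : ℕ} {k l : Fin n → ℕ} (e : ∀ i, Fin (k i) ≃ Fin (l i))
    (x : obj n) (y : ∀ i, obj (l i)),
    comp k x (fun i => act (e i) (y i)) = act (sumEquiv e) (comp l x y)

/-- A morphism of operads: chain maps of degree 0 in each arity, compatible with the actions of the
symmetric groups, the units and the compositions. -/
structure OperadHom {R : Type u} [CommRing R] (V : OperadData.{u, v} R)
    (W : OperadData.{u, w} R) where
  app : ∀ n, V.obj n →ₗ[R] W.obj n
  app_mem : ∀ n k, ∀ x ∈ V.gr n k, app n x ∈ W.gr n k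
  app_d : ∀ n x, app n (V.d n x) = W.d n (app n x)
  app_act : ∀ {a b : ℕ} (e : Fin a ≃ Fin b) (x : V.obj b), app a (V.act e x) = W.act e (app b x)
  app_one : app 1 V.one = W.one
  app_comp : ∀ {n : ℕ} (k : Fin n → ℕ) (x : V.obj n) (y : ∀ i, V.obj (k i)),
    app _ (V.comp k x y) = W.comp k (app n x) (fun i => app (k i) (y i))

/-! ### The Barratt-Eccles operad -/

namespace BarrattEccles

/-- The nondegenerate simplices `(w₀, …, w_k)` of the simplicial set with `k`-simplices
`(S_n)^(k+1)`, the universal cover of `K(S_n, 1)`; the first entry is the dimension. -/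
def Simplex (n : ℕ) : Type :=
  (k : ℕ) × {w : Fin (k + 1) → Equiv.Perm (Fin n) // ∀ i : Fin k, w i.castSucc ≠ w i.succ}

variable (R : Type u) [CommRing R]

open Classical in
/-- The class of a simplex in the normalized chains: degenerate simplices are zero. -/
noncomputable def cell {n k : ℕ} (w : Fin (k + 1) → Equiv.Perm (Fin n)) : Simplex n →₀ R :=
  if h : ∀ i : Fin k, w i.castSucc ≠ w i.succ then Finsupp.single ⟨k, w, h⟩ 1 else 0

/-- The degree `k` normalized chains. -/
def gr (n : ℕ) (k : ℤ) : Submodule R (Simplex n →₀ R) :=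
  Finsupp.supported R R {s | (s.1 : ℤ) = k}

/-- The alternating sum of the faces of a simplex. -/
noncomputable def boundary {n : ℕ} : Simplex n → (Simplex n →₀ R)
  | ⟨0, _⟩ => 0
  | ⟨k + 1, w⟩ => ∑ i : Fin (k + 2), (-1 : ℤ) ^ (i : ℕ) • cell R (fun t => w.1 (i.succAbove t))

/-- The right action of `S_n` by `w ↦ w σ` (transported along `a = b`). -/
def permAct {a b : ℕ} (e : Fin a ≃ Fin b) (w : Equiv.Perm (Fin b)) : Equiv.Perm (Fin a) :=
  e.trans (w.trans (finCongr (Fin.equiv_iff_eq.mp ⟨e⟩).symm))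

/-- Composition of permutations: `vᵢ` permutes the letters of the `i`-th block, and `w` permutes
the blocks. -/
def permComp {n : ℕ} {k : Fin n → ℕ} (w : Equiv.Perm (Fin n))
    (v : ∀ i, Equiv.Perm (Fin (k i))) : Equiv.Perm (Fin (∑ i, k i)) :=
  (sumEquiv v).trans ((blockEquiv w.symm k).symm.trans (finCongr (Equiv.sum_comp w.symm k)))

/-- The dimensions of a simplex and of a family of simplices, in one list. -/
def dims {n : ℕ} {k : Fin n → ℕ} (w : Simplex n) (v : ∀ i, Simplex (k i)) : Fin (n + 1) → ℕ :=
  Fin.cons w.1 (fun i => (v i).1)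

/-- The lattice paths from the origin to the point with coordinates `D`, given by the directions
of their unit steps. -/
def paths {r : ℕ} (D : Fin r → ℕ) : Finset (Fin (∑ j, D j) → Fin r) :=
  Finset.univ.filter fun a => ∀ j, (Finset.univ.filter fun t => a t = j).card = D j

/-- The `j`-th coordinate of a lattice path after `t` steps. -/
def coord {r N : ℕ} (a : Fin N → Fin r) (j : Fin r) (t : ℕ) : ℕ :=
  (Finset.univ.filter fun t' : Fin N => (t' : ℕ) < t ∧ a t' = j).card

/-- The number of inversions of the sequence of directions of a lattice path. -/
def inversions {r N : ℕ} (a : Fin N → Fin r) : ℕ :=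
  (Finset.univ.filter fun t : Fin N × Fin N => t.1 < t.2 ∧ a t.2 < a t.1).card

/-- The composition of simplices: the Eilenberg-Zilber shuffle product of `w, v₁, …, vₙ`, which
is the signed sum over all lattice paths, followed by the composition of permutations in each
vertex. -/
noncomputable def simplexComp {n : ℕ} {k : Fin n → ℕ} (w : Simplex n) (v : ∀ i, Simplex (k i)) :
    Simplex (∑ i, k i) →₀ R :=
  ∑ a ∈ paths (dims w v), (-1 : ℤ) ^ inversions a •
    cell R (fun t : Fin ((∑ j, dims w v j) + 1) =>
      permComp (w.2.1 (Fin.ofNat _ (coord a 0 t)))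
        (fun i => (v i).2.1 (Fin.ofNat _ (coord a i.succ t))))

open Classical in
/-- The Barratt-Eccles operad over `R`: the normalized chains of the universal covers of the spaces
`K(S_n, 1)`. -/
noncomputable def operad : OperadData.{u, u} R where
  obj n := Simplex n →₀ R
  gr n := gr R n
  d n := Finsupp.linearCombination R (boundary R)
  act e := Finsupp.linearCombination R (fun s => cell R (fun t => permAct e (s.2.1 t)))
  one := cell R (fun _ : Fin 1 => Equiv.refl (Fin 1))
  comp k := Finsupp.linearCombination R (fun w =>
    ((Finsupp.linearCombination R (fun v : ∀ i, Simplex (k i) => simplexComp R w v)) ∘ₗ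
      (PiTensorProduct.ofFinsuppEquiv' (R := R)).toLinearMap).compMultilinearMap
        (PiTensorProduct.tprod R))

theorem internal (n : ℕ) : DirectSum.IsInternal ((operad R).gr n) := by
  rw [DirectSum.isInternal_submodule_iff_iSupIndep_and_iSup_eq_top]
  constructor
  · intro k
    have : (⨆ j, ⨆ (_ : j ≠ k), (operad R).gr n j) ≤
        Finsupp.supported R R {s : Simplex n | (s.1 : ℤ) ≠ k} :=
      iSup₂_le fun j hj => Finsupp.supported_mono (by rintro s rfl; exact hj)
    refine Disjoint.mono_right this ?_
    refine Finsupp.disjoint_supported_supported ?_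
    rw [Set.disjoint_left]
    intro s hs hs'
    exact hs' hs
  · change (⨆ k : ℤ, Finsupp.supported R R {s : Simplex n | (s.1 : ℤ) = k}) = ⊤
    rw [← Finsupp.supported_iUnion, ← Finsupp.supported_univ]
    congr 1
    ext s
    simp

/-- The augmentation of the Barratt-Eccles operad, which sends each vertex to `1`. -/
noncomputable def augmentation (n : ℕ) : (operad R).obj n →ₗ[R] R :=
  Finsupp.linearCombination R (fun s : Simplex n => if s.1 = 0 then (1 : R) else 0)

end BarrattEccles

/-! ### Tensor products of operads -/

section Hadamard

variable {R : Type u} [CommRing R] (V : OperadData.{u, v} R) (W : OperadData.{u, w} R)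

/-- The composition of the tensor product of two operads without signs:
`(x ⊗ a; y₁ ⊗ b₁, …, yₙ ⊗ bₙ) ↦ γ(x; y₁, …, yₙ) ⊗ γ(a; b₁, …, bₙ)`. -/
noncomputable def tensorCompUnsigned {n : ℕ} (k : Fin n → ℕ) :
    (V.obj n ⊗[R] W.obj n) →ₗ[R]
      MultilinearMap R (fun i => V.obj (k i) ⊗[R] W.obj (k i))
        (V.obj (∑ i, k i) ⊗[R] W.obj (∑ i, k i)) :=
  TensorProduct.lift (LinearMap.mk₂ R
    (fun x a =>
      (TensorProduct.map (PiTensorProduct.lift (V.comp k x))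
        (PiTensorProduct.lift (W.comp k a))).compMultilinearMap
          (interchange (fun i => V.obj (k i)) (fun i => W.obj (k i))))
    (by intro x x' a; ext y; simp [TensorProduct.map_add_left])
    (by intro c x a; ext y; simp [TensorProduct.map_smul_left])
    (by intro x a a'; ext y; simp [TensorProduct.map_add_right])
    (by intro c x a; ext y; simp [TensorProduct.map_smul_right]))

theorem tensorCompUnsigned_tmul {n : ℕ} (k : Fin n → ℕ) (x : V.obj n) (a : W.obj n)
    (y : ∀ i, V.obj (k i)) (b : ∀ i, W.obj (k i)) :
    tensorCompUnsigned V W k (x ⊗ₜ a) (fun i => y i ⊗ₜ b i) =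
      V.comp k x y ⊗ₜ W.comp k a b := by
  simp [tensorCompUnsigned, interchange_tmul]

variable (hV : ∀ n, DirectSum.IsInternal (V.gr n)) (hW : ∀ n, DirectSum.IsInternal (W.gr n))

/-- The projection of `V(n) ⊗ W(n)` onto the part of bi-parity `(e, e')`. -/
noncomputable def biparity (n : ℕ) (e e' : Fin 2) :
    (V.obj n ⊗[R] W.obj n) →ₗ[R] (V.obj n ⊗[R] W.obj n) :=
  TensorProduct.map (parityProj (hV n) e) (parityProj (hW n) e')

/-- The tensor product of operads, `(V ⊗ W)(n) = V(n) ⊗ W(n)`, with the diagonal actions and the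
compositions of both factors. The sign in the composition of `x ⊗ a` with the `yᵢ ⊗ bᵢ` is the
Koszul sign of the rearrangement of `x a y₁ b₁ ⋯ yₙ bₙ` into `x y₁ ⋯ yₙ a b₁ ⋯ bₙ`. -/
noncomputable def tensorOperad : OperadData.{u, max v w} R where
  obj n := V.obj n ⊗[R] W.obj n
  gr n m := ⨆ p : ℤ, LinearMap.range
    (TensorProduct.map (V.gr n p).subtype (W.gr n (m - p)).subtype)
  d n := TensorProduct.map (V.d n) LinearMap.id + TensorProduct.map (signInv (hV n)) (W.d n)
  act e := TensorProduct.map (V.act e) (W.act e)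
  one := V.one ⊗ₜ[R] W.one
  comp {n} k :=
    ∑ ex : Fin 2, ∑ ea : Fin 2, ∑ ey : Fin n → Fin 2, ∑ eb : Fin n → Fin 2,
      ((∑ i, ((ea : ℕ) : ℤ) * par ey i) +
          ∑ i, ∑ j, if i < j then par eb i * par ey j else 0).negOnePow •
        (MultilinearMap.compLinearMapₗ
            (fun i => biparity V W hV hW (k i) (ey i) (eb i)) ∘ₗ
          tensorCompUnsigned V W k ∘ₗ biparity V W hV hW n ex ea)

end Hadamard

/-! ### Coalgebras over an operad -/

section Coalgebra

variable {R : Type u} [CommRing R]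

/-- The map `Hom(C, C^{⊗k₁}) ⊗ ⋯ ⊗ Hom(C, C^{⊗kₙ}) → Hom(C^{⊗n}, C^{⊗(k₁+⋯+kₙ)})` that enters
the compositions of the coendomorphism operad: up to sign `(g₁, …, gₙ) ↦ g₁ ⊗ ⋯ ⊗ gₙ`. The
summand of index `u, v` is the part of parity `u i` in the `i`-th input and of parity `v i` in the
`i`-th output; the sign is explained at `coEnd`. -/
noncomputable def coEndTensor (C : DGModule.{u, v} R) {n : ℕ} (k : Fin n → ℕ) :
    MultilinearMap R (fun i => C.carrier →ₗ[R] C.Pow (k i)) (C.Pow n →ₗ[R] C.Pow (∑ i, k i)) :=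
  ∑ u : Fin n → Fin 2, ∑ v : Fin n → Fin 2,
    (∑ i, ∑ j, if i < j then (par u j + par v j) * par v i else 0).negOnePow •
      (LinearMap.llcomp R _ _ _ (flatten C.carrier k)).compMultilinearMap
        ((PiTensorProduct.mapMultilinear R (fun _ => C.carrier) (fun i => C.Pow (k i))).compLinearMap
          (fun i => LinearMap.llcomp R _ _ _ (C.powParity (k i) (v i)) ∘ₗ
            LinearMap.lcomp R _ (parityProj C.internal (u i))))

/-- The coendomorphism operad of a chain complex `C`, `CoEnd(C)(n) = Hom_R(C, C^{⊗n})`. The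
differential is `d f = f ∘ d - (-1) ^ deg f • d ∘ f`; note that `(-1) ^ deg f • f` is the
conjugate of `f` by the sign involutions. The symmetric groups act by permutation of the factors of
`C^{⊗n}`. The composition of `f` with `g₁, …, gₙ` is `(g₁ ⊗ ⋯ ⊗ gₙ) ∘ f`, with the Koszul sign
`(-1) ^ ∑_{i<j} deg gⱼ * deg xᵢ` in the value of `g₁ ⊗ ⋯ ⊗ gₙ` at `x₁ ⊗ ⋯ ⊗ xₙ`, and with the sign
`(-1) ^ ∑_{i<j} deg gᵢ * deg gⱼ` which makes the composition a chain map for the differential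
above; since `deg gᵢ xᵢ = deg gᵢ + deg xᵢ`, the two signs combine to
`(-1) ^ ∑_{i<j} deg gⱼ * deg gᵢ xᵢ`. -/
noncomputable def coEnd (C : DGModule.{u, v} R) : OperadData.{u, max u v} R where
  obj n := C.carrier →ₗ[R] C.Pow n
  gr n k := ⨅ j : ℤ, Submodule.compatibleMaps (C.gr j) (C.powGr n (j + k))
  d n :=
    { toFun := fun f => f ∘ₗ C.d - C.powD n ∘ₗ (C.powSign n ∘ₗ f ∘ₗ signInv C.internal)
      map_add' := by intro f g; ext x; simp; abel
      map_smul' := by intro c f; ext x; simp [smul_sub] }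
  act e := LinearMap.llcomp R _ _ _ (C.powPerm e.symm)
  one := (PiTensorProduct.subsingletonEquiv (s := fun _ => C.carrier) (0 : Fin 1)).symm.toLinearMap
  comp k :=
    { toFun := fun f => (LinearMap.lcomp R _ f).compMultilinearMap (coEndTensor C k)
      map_add' := by intro f f'; ext g x; simp
      map_smul' := by intro c f; ext g x; simp }

/-- The symmetric group `S_n` acting from the left on `V(n)`, by inverting the right action. -/
def Operad.rep (V : Operad.{u, v} R) (n : ℕ) : Representation R (Equiv.Perm (Fin n)) (V.obj n) where
  toFun σ := V.act σ⁻¹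
  map_one' := LinearMap.ext fun x => V.act_refl x
  map_mul' σ τ := LinearMap.ext fun x => by
    rw [mul_inv_rev]
    exact V.act_trans σ⁻¹ τ⁻¹ x

/-- The standing condition on an operad `V`:
* there is a morphism of operads `δ : V → V ⊗ 𝔖` to the tensor product of `V` with the
  Barratt-Eccles operad whose composite with the projection `V ⊗ 𝔖 → V` given by the augmentation
  of `𝔖` is the identity;
* each `V(n)` is `R S_n`-projective and of finite type (finitely generated in each degree);
* `V(1)` is equal to `R`, generated by the unit. -/
structure Operad.Admissible (V : Operad.{u, v} R) : Prop where
  exists_diagonal : ∃ δ : OperadHom V.toOperadData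
      (tensorOperad V.toOperadData (BarrattEccles.operad R) V.internal (BarrattEccles.internal R)),
    ∀ n x, TensorProduct.rid R (V.obj n)
      (LinearMap.lTensor (V.obj n) (BarrattEccles.augmentation R n) (δ.app n x)) = x
  projective : ∀ n, Module.Projective (MonoidAlgebra R (Equiv.Perm (Fin n))) (V.rep n).asModule
  finite_type : ∀ n k, (V.gr n k).FG
  arity_one : Function.Bijective (fun r : R => r • V.one)

/-- A coalgebra over the operad `V`: a chain complex `C` with a morphism of operads
`V → CoEnd(C)`. -/
structure Coalgebra (V : Operad.{u, v} R) where
  cx : DGModule.{u, w} R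
  str : OperadHom V.toOperadData (coEnd cx)

/-- The structure map `C → C^{⊗n}` given by an element of `V(n)`. -/
def Coalgebra.cop {V : Operad.{u, v} R} (C : Coalgebra.{u, v, w} V) (n : ℕ) :
    V.obj n →ₗ[R] (C.cx.carrier →ₗ[R] C.cx.Pow n) :=
  C.str.app n

/-- Morphisms of `V`-coalgebras: chain maps of degree 0 that commute with all structure maps
`C → C^{⊗n}`. -/
structure IsCoalgebraHom {V : Operad.{u, v} R} (C : Coalgebra.{u, v, w} V)
    (D : Coalgebra.{u, v, u'} V) (f : C.cx.carrier →ₗ[R] D.cx.carrier) : Prop where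
  map_mem : ∀ k, ∀ x ∈ C.cx.gr k, f x ∈ D.cx.gr k
  map_d : ∀ x, f (C.cx.d x) = D.cx.d (f x)
  map_str : ∀ n (v : V.obj n) (x : C.cx.carrier),
    PiTensorProduct.map (fun _ => f) (C.cop n v x) = D.cop n v (f x)

/-- A subcomplex of a chain complex: a graded submodule that is closed under the differential. -/
structure Subcomplex (C : DGModule.{u, v} R) where
  toSubmodule : Submodule R C.carrier
  graded : toSubmodule ≤ ⨆ k, toSubmodule ⊓ C.gr k
  d_mem : ∀ x ∈ toSubmodule, C.d x ∈ toSubmodule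

/-- A subcomplex as a chain complex. -/
def Subcomplex.toDGModule {C : DGModule.{u, v} R} (D : Subcomplex C) : DGModule.{u, v} R where
  carrier := D.toSubmodule
  gr k := (C.gr k).comap D.toSubmodule.subtype
  internal := by
    have hC := (DirectSum.isInternal_submodule_iff_iSupIndep_and_iSup_eq_top _).1 C.internal
    refine (DirectSum.isInternal_submodule_iff_iSupIndep_and_iSup_eq_top _).2 ⟨?_, ?_⟩
    · intro k
      rw [Submodule.disjoint_def]
      intro x hx hx'
      have h1 := Submodule.mem_map_of_mem (f := D.toSubmodule.subtype) hx'
      have h2 : (⨆ j, ⨆ (_ : j ≠ k), (C.gr j).comap D.toSubmodule.subtype).map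
          D.toSubmodule.subtype ≤ ⨆ j, ⨆ (_ : j ≠ k), C.gr j := by
        simp only [Submodule.map_iSup]
        exact iSup₂_mono fun j _ => Submodule.map_comap_le _ _
      exact Subtype.ext (Submodule.disjoint_def.1 (hC.1 k) _ hx (h2 h1))
    · refine Submodule.map_injective_of_injective D.toSubmodule.injective_subtype ?_
      simp only [Submodule.map_iSup, Submodule.map_comap_subtype, Submodule.map_subtype_top]
      exact le_antisymm (iSup_le fun k => inf_le_left) D.graded
  d := C.d.restrict D.d_mem
  d_mem k x hx := C.d_mem k x hx
  d_d x := Subtype.ext (C.d_d x)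

/-- A sub-coalgebra of `C`: a subcomplex with the structure of a `V`-coalgebra for which the
inclusion is a morphism of coalgebras. -/
structure SubCoalgebra {V : Operad.{u, v} R} (C : Coalgebra.{u, v, w} V) where
  sub : Subcomplex C.cx
  str : OperadHom V.toOperadData (coEnd sub.toDGModule)
  incl : IsCoalgebraHom ⟨sub.toDGModule, str⟩ C sub.toSubmodule.subtype

/-- A sub-coalgebra as a coalgebra. -/
def SubCoalgebra.toCoalgebra {V : Operad.{u, v} R} {C : Coalgebra.{u, v, w} V}
    (A : SubCoalgebra C) : Coalgebra.{u, v, w} V :=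
  ⟨A.sub.toDGModule, A.str⟩

/-- The underlying submodule of a sub-coalgebra. -/
def SubCoalgebra.toSubmodule {V : Operad.{u, v} R} {C : Coalgebra.{u, v, w} V}
    (A : SubCoalgebra C) : Submodule R C.cx.carrier :=
  A.sub.toSubmodule

/-- A module is nearly free if every countable submodule is free. -/
def NearlyFree (R : Type u) [CommRing R] (M : Type v) [AddCommGroup M] [Module R M] : Prop :=
  ∀ N : Submodule R M, Countable N → Module.Free R N

end Coalgebra

end DGOperad

/-!
Let `S` be a subcomplex of `C` whose tensor powers embed into those of `C`. If every cooperation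
of `C` carries `S` into the image of `S ⊗ ⋯ ⊗ S`, then it lifts uniquely to `S`, and the lifts
inherit the operad identities and the degrees from `C`, since the embedding commutes with all the
operations of the coendomorphism operads and can be cancelled. The tensor powers do embed when `S`
is countable: countable submodules of `C` are flat, and so is `C` itself, because flatness is a
condition on finite linear relations, which live in finitely generated, hence countable, submodules.

Each value of a cooperation is a finite sum of pure tensors, and `V` has only countably many
operations, so closing a countable set under the differential, the homogeneous components and the
tensor factors of all cooperations again gives a countable submodule.
-/

namespace DGOperad

variable {R : Type u} [CommRing R]

section Flat

theorem flat_of_forall_fg_flat {M : Type v} [AddCommGroup M] [Module R M]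
    (h : ∀ N : Submodule R M, N.FG → Module.Flat R N) : Module.Flat R M := by
  refine Module.Flat.of_forall_isTrivialRelation fun {l f x} hfx => ?_
  let N := Submodule.span R (Set.range x)
  have := h N (Submodule.fg_span (Set.finite_range x))
  let x' : Fin l → N := fun i => ⟨x i, Submodule.subset_span ⟨i, rfl⟩⟩
  have hfx' : ∑ i, f i • x' i = 0 := Subtype.ext <| by
    rw [Submodule.coe_sum]
    exact hfx
  obtain ⟨k, a, y, hxy, ha⟩ := Module.Flat.isTrivialRelation_of_sum_smul_eq_zero hfx'
  refine ⟨k, a, fun j => y j, fun i => ?_, ha⟩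
  simpa [x'] using congrArg N.subtype (hxy i)

/-- The factor indexed by `none` split off from a tensor product over `Option ι`. -/
noncomputable def piTensorOptionEquiv {ι : Type*} (M : Option ι → Type v)
    [∀ i, AddCommGroup (M i)] [∀ i, Module R (M i)] :
    (⨂[R] i, M i) ≃ₗ[R] (⨂[R] i : ι, M (some i)) ⊗[R] M none :=
  let e := Equiv.optionEquivSumPUnit.{0} ι
  (PiTensorProduct.reindex R M e).trans <|
    (PiTensorProduct.tmulEquivDep R fun i => M (e.symm i)).symm.trans <|
      LinearEquiv.lTensor (⨂[R] i : ι, M (some i))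
        (PiTensorProduct.subsingletonEquiv (R := R) (s := fun _ => M none) PUnit.unit)

theorem piTensorOptionEquiv_tprod {ι : Type*} (M : Option ι → Type v)
    [∀ i, AddCommGroup (M i)] [∀ i, Module R (M i)] (x : ∀ i, M i) :
    piTensorOptionEquiv M (PiTensorProduct.tprod R x) =
      PiTensorProduct.tprod R (fun i => x (some i)) ⊗ₜ[R] x none := by
  let e := Equiv.optionEquivSumPUnit.{0} ι
  let p := LinearEquiv.lTensor (⨂[R] i : ι, M (some i))
    (PiTensorProduct.subsingletonEquiv (R := R) (s := fun _ => M none) PUnit.unit)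
  calc piTensorOptionEquiv M (PiTensorProduct.tprod R x)
      = p ((PiTensorProduct.tmulEquivDep R fun i => M (e.symm i)).symm
          (PiTensorProduct.tprod R fun i => x (e.symm i))) :=
        congrArg (fun t => p ((PiTensorProduct.tmulEquivDep R fun i => M (e.symm i)).symm t))
          (PiTensorProduct.reindex_tprod e x)
    _ = p (PiTensorProduct.tprod R (fun i => x (some i)) ⊗ₜ[R]
          PiTensorProduct.tprod R fun _ => x none) :=
        congrArg p (PiTensorProduct.tmulEquivDep_symm_apply R (fun i => M (e.symm i)) _)
    _ = PiTensorProduct.tprod R (fun i => x (some i)) ⊗ₜ[R] x none := by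
        simp [p, PiTensorProduct.subsingletonEquiv_apply_tprod]

theorem flat_piTensorProduct {ι : Type*} [Finite ι] (M : ι → Type v) [∀ i, AddCommGroup (M i)]
    [∀ i, Module R (M i)] [∀ i, Module.Flat R (M i)] : Module.Flat R (⨂[R] i, M i) := by
  induction ι using Finite.induction_empty_option with
  | of_equiv e ih =>
    have := ih fun i => M (e i)
    exact .of_linearEquiv (PiTensorProduct.reindex R M e.symm)
  | h_empty => exact .of_linearEquiv (PiTensorProduct.isEmptyEquiv PEmpty)
  | h_option ih =>
    have := ih fun i => M (some i)
    exact .of_linearEquiv (piTensorOptionEquiv M)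

theorem injective_of_comp_equiv_eq {M N M' N' : Type*} [AddCommGroup M] [Module R M]
    [AddCommGroup N] [Module R N] [AddCommGroup M'] [Module R M'] [AddCommGroup N'] [Module R N']
    {f : M →ₗ[R] N} {g : M' →ₗ[R] N'} (hg : Function.Injective g) (e : M ≃ₗ[R] M')
    (e' : N ≃ₗ[R] N') (h : e'.toLinearMap ∘ₗ f = g ∘ₗ e.toLinearMap) : Function.Injective f := by
  have hef : Function.Injective (e'.toLinearMap ∘ₗ f) := h ▸ hg.comp e.injective
  exact Function.Injective.of_comp (f := e') hef

theorem piTensorProduct_map_injective_of_flat {ι : Type*} [Finite ι] {M : ι → Type v}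
    {N : ι → Type w} [∀ i, AddCommGroup (M i)] [∀ i, Module R (M i)] [∀ i, AddCommGroup (N i)]
    [∀ i, Module R (N i)] [∀ i, Module.Flat R (M i)] [∀ i, Module.Flat R (N i)]
    {f : ∀ i, M i →ₗ[R] N i} (hf : ∀ i, Function.Injective (f i)) :
    Function.Injective (PiTensorProduct.map f) := by
  induction ι using Finite.induction_empty_option with
  | of_equiv e ih =>
    exact injective_of_comp_equiv_eq (ih fun i => hf (e i))
      (PiTensorProduct.reindex R M e.symm) (PiTensorProduct.reindex R N e.symm)
      (PiTensorProduct.map_comp_reindex_eq f e.symm).symm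
  | h_empty =>
    exact injective_of_comp_equiv_eq (g := LinearMap.id) Function.injective_id
      (PiTensorProduct.isEmptyEquiv PEmpty) (PiTensorProduct.isEmptyEquiv PEmpty)
      (by ext x; simp)
  | h_option ih =>
    have := flat_piTensorProduct (R := R) fun i => M (some i)
    have := flat_piTensorProduct (R := R) fun i => N (some i)
    refine injective_of_comp_equiv_eq
      (TensorProduct.map_injective_of_flat_flat' _ _ (ih fun i => hf (some i)) (hf none))
      (piTensorOptionEquiv M) (piTensorOptionEquiv N) (PiTensorProduct.ext ?_)
    ext x
    simp [piTensorOptionEquiv_tprod]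

end Flat

section Graded

variable {M : Type v} [AddCommGroup M] [Module R M]
  {N : Type w} [AddCommGroup N] [Module R N] {ι : Type*} [DecidableEq ι]

theorem ext_of_isInternal {gr : ι → Submodule R M} (h : DirectSum.IsInternal gr)
    {f g : M →ₗ[R] N} (hfg : ∀ k, ∀ x ∈ gr k, f x = g x) : f = g := by
  have hle : ⨆ k, gr k ≤ LinearMap.eqLocus f g := iSup_le hfg
  exact LinearMap.ext fun x => hle (h.submodule_iSup_eq_top ▸ Submodule.mem_top)

theorem parityProj_of_mem {gr : ℤ → Submodule R M} (h : DirectSum.IsInternal gr) (e : Fin 2)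
    {k : ℤ} {x : M} (hx : x ∈ gr k) :
    parityProj h e x = if k % 2 = ((e : ℕ) : ℤ) then x else 0 := by
  have hx' : (LinearEquiv.ofBijective (DirectSum.coeLinearMap gr) h).symm x =
      DirectSum.lof R ℤ (fun k => gr k) k ⟨x, hx⟩ :=
    (LinearEquiv.symm_apply_eq _).2 (DirectSum.coeLinearMap_lof gr k ⟨x, hx⟩).symm
  rw [parityProj, LinearMap.comp_apply, LinearEquiv.coe_coe, hx', DirectSum.toModule_lof]
  split_ifs <;> rfl

/-- The projection of a graded module onto its component of degree `k`, as an endomorphism. -/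
noncomputable def degreeProj {gr : ι → Submodule R M} (h : DirectSum.IsInternal gr) (k : ι) :
    M →ₗ[R] M :=
  (gr k).subtype ∘ₗ DirectSum.component R ι (fun k => gr k) k ∘ₗ
    (LinearEquiv.ofBijective (DirectSum.coeLinearMap gr) h).symm.toLinearMap

theorem degreeProj_mem {gr : ι → Submodule R M} (h : DirectSum.IsInternal gr) (k : ι) (x : M) :
    degreeProj h k x ∈ gr k :=
  Subtype.property _

theorem degreeProj_of_mem {gr : ι → Submodule R M} (h : DirectSum.IsInternal gr) (j : ι)
    {k : ι} {x : M} (hx : x ∈ gr k) : degreeProj h j x = if k = j then x else 0 := by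
  split_ifs with hkj
  · subst hkj
    exact congrArg Subtype.val (h.ofBijective_coeLinearMap_of_mem hx)
  · exact congrArg Subtype.val (h.ofBijective_coeLinearMap_of_mem_ne hkj hx)

theorem exists_sum_degreeProj {gr : ι → Submodule R M} (h : DirectSum.IsInternal gr) (x : M) :
    ∃ s : Finset ι, ∑ k ∈ s, degreeProj h k x = x ∧ ∀ k ∉ s, degreeProj h k x = 0 := by
  classical
  let e := LinearEquiv.ofBijective (DirectSum.coeLinearMap gr) h
  refine ⟨DFinsupp.support (e.symm x), ?_, fun k hk => ?_⟩
  · calc ∑ k ∈ DFinsupp.support (e.symm x), degreeProj h k x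
        = DirectSum.coeLinearMap gr (e.symm x) :=
          (DirectSum.coeLinearMap_eq_dfinsuppSum gr (e.symm x)).symm
      _ = x := e.apply_symm_apply x
  · have hek : e.symm x k = 0 := by simpa using hk
    exact congrArg Subtype.val hek

theorem le_iSup_inf_of_degreeProj_mem {gr : ι → Submodule R M} (h : DirectSum.IsInternal gr)
    {S : Submodule R M} (hS : ∀ k, ∀ x ∈ S, degreeProj h k x ∈ S) : S ≤ ⨆ k, S ⊓ gr k := by
  intro x hx
  obtain ⟨s, hs, -⟩ := exists_sum_degreeProj h x
  exact hs ▸ Submodule.sum_mem _ fun k _ =>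
    Submodule.mem_iSup_of_mem k ⟨hS k x hx, degreeProj_mem h k x⟩

theorem comp_degreeProj {gr : ι → Submodule R M} {gr' : ι → Submodule R N}
    (h : DirectSum.IsInternal gr) (h' : DirectSum.IsInternal gr') {f : M →ₗ[R] N}
    (hf : ∀ k, ∀ x ∈ gr k, f x ∈ gr' k) (j : ι) :
    f ∘ₗ degreeProj h j = degreeProj h' j ∘ₗ f := by
  refine ext_of_isInternal h fun k x hx => ?_
  rw [LinearMap.comp_apply, LinearMap.comp_apply, degreeProj_of_mem h j hx,
    degreeProj_of_mem h' j (hf k x hx), apply_ite f, map_zero]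

variable {gr : ℤ → Submodule R M} {gr' : ℤ → Submodule R N}

theorem comp_parityProj (h : DirectSum.IsInternal gr) (h' : DirectSum.IsInternal gr')
    {f : M →ₗ[R] N} (hf : ∀ k, ∀ x ∈ gr k, f x ∈ gr' k) (e : Fin 2) :
    f ∘ₗ parityProj h e = parityProj h' e ∘ₗ f := by
  refine ext_of_isInternal h fun k x hx => ?_
  rw [LinearMap.comp_apply, LinearMap.comp_apply, parityProj_of_mem h e hx,
    parityProj_of_mem h' e (hf k x hx), apply_ite f, map_zero]

theorem comp_signInv (h : DirectSum.IsInternal gr) (h' : DirectSum.IsInternal gr')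
    {f : M →ₗ[R] N} (hf : ∀ k, ∀ x ∈ gr k, f x ∈ gr' k) :
    f ∘ₗ signInv h = signInv h' ∘ₗ f := by
  rw [signInv, signInv, LinearMap.comp_sub, LinearMap.sub_comp, comp_parityProj h h' hf,
    comp_parityProj h h' hf]

end Graded

section TensorPower

theorem piTensorProduct_map_comp_map_comm {ι : Type*} {M N M' N' : ι → Type*}
    [∀ i, AddCommGroup (M i)] [∀ i, Module R (M i)] [∀ i, AddCommGroup (N i)]
    [∀ i, Module R (N i)] [∀ i, AddCommGroup (M' i)] [∀ i, Module R (M' i)]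
    [∀ i, AddCommGroup (N' i)] [∀ i, Module R (N' i)]
    {f : ∀ i, M i →ₗ[R] N i} {f' : ∀ i, M' i →ₗ[R] N' i}
    {g : ∀ i, M i →ₗ[R] M' i} {g' : ∀ i, N i →ₗ[R] N' i} (h : ∀ i, f' i ∘ₗ g i = g' i ∘ₗ f i) :
    PiTensorProduct.map f' ∘ₗ PiTensorProduct.map g =
      PiTensorProduct.map g' ∘ₗ PiTensorProduct.map f := by
  rw [← PiTensorProduct.map_comp, ← PiTensorProduct.map_comp, funext h]

section Modules

variable {M : Type v} [AddCommGroup M] [Module R M] {N : Type w} [AddCommGroup N] [Module R N]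

/-- The `n`-th tensor power `f ⊗ ⋯ ⊗ f` of a linear map. -/
noncomputable abbrev powMap (f : M →ₗ[R] N) (n : ℕ) :
    (⨂[R] _ : Fin n, M) →ₗ[R] ⨂[R] _ : Fin n, N :=
  PiTensorProduct.map fun _ => f

theorem powMap_comp_flatten (f : M →ₗ[R] N) {n : ℕ} (k : Fin n → ℕ) :
    powMap f (∑ i, k i) ∘ₗ flatten M k =
      flatten N k ∘ₗ PiTensorProduct.map (fun i => powMap f (k i)) := by
  refine PiTensorProduct.ext_of_span_eq_top
    (g := fun i => (PiTensorProduct.tprod R : MultilinearMap R (fun _ : Fin (k i) => M) _))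
    (fun i => PiTensorProduct.span_tprod_eq_top) fun x => ?_
  simp only [LinearMap.comp_apply, PiTensorProduct.map_tprod, flatten_tprod]

/-- The linear map `f` carries the `n`-ary cooperation `g` to the `n`-ary cooperation `g'`. -/
def Intertwines (f : M →ₗ[R] N) {n : ℕ} (g : M →ₗ[R] ⨂[R] _ : Fin n, M)
    (g' : N →ₗ[R] ⨂[R] _ : Fin n, N) : Prop :=
  powMap f n ∘ₗ g = g' ∘ₗ f

theorem Intertwines.left_unique {f : M →ₗ[R] N} {n : ℕ} {g₁ g₂ : M →ₗ[R] ⨂[R] _ : Fin n, M}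
    {g' : N →ₗ[R] ⨂[R] _ : Fin n, N} (hf : Function.Injective (powMap f n))
    (h₁ : Intertwines f g₁ g') (h₂ : Intertwines f g₂ g') : g₁ = g₂ :=
  LinearMap.cancel_left hf |>.1 (h₁.trans h₂.symm)

end Modules

variable {C : DGModule.{u, v} R} {D : DGModule.{u, w} R} {f : C.carrier →ₗ[R] D.carrier}

theorem powMap_comp_powD (hf : ∀ k, ∀ x ∈ C.gr k, f x ∈ D.gr k) (hd : f ∘ₗ C.d = D.d ∘ₗ f)
    (n : ℕ) : powMap f n ∘ₗ C.powD n = D.powD n ∘ₗ powMap f n := by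
  have hfactor (i j : Fin n) :
      f ∘ₗ (if j < i then signInv C.internal else if j = i then C.d else LinearMap.id) =
        (if j < i then signInv D.internal else if j = i then D.d else LinearMap.id) ∘ₗ f := by
    split_ifs
    exacts [comp_signInv _ _ hf, hd, rfl]
  refine LinearMap.ext fun t => ?_
  simp only [DGModule.powD, LinearMap.comp_apply, LinearMap.sum_apply, map_sum]
  exact Finset.sum_congr rfl fun i _ =>
    LinearMap.congr_fun (piTensorProduct_map_comp_map_comm (hfactor i)) t

theorem powMap_comp_powSign (hf : ∀ k, ∀ x ∈ C.gr k, f x ∈ D.gr k) (n : ℕ) :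
    powMap f n ∘ₗ C.powSign n = D.powSign n ∘ₗ powMap f n :=
  piTensorProduct_map_comp_map_comm fun _ => comp_signInv _ _ hf

theorem powMap_comp_map_parityProj (hf : ∀ k, ∀ x ∈ C.gr k, f x ∈ D.gr k) {n : ℕ}
    (ε : Fin n → Fin 2) :
    powMap f n ∘ₗ PiTensorProduct.map (fun i => parityProj C.internal (ε i)) =
      PiTensorProduct.map (fun i => parityProj D.internal (ε i)) ∘ₗ powMap f n :=
  piTensorProduct_map_comp_map_comm fun i => comp_parityProj _ _ hf (ε i)

theorem powMap_comp_powParity (hf : ∀ k, ∀ x ∈ C.gr k, f x ∈ D.gr k) (n : ℕ) (e : Fin 2) :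
    powMap f n ∘ₗ C.powParity n e = D.powParity n e ∘ₗ powMap f n := by
  refine LinearMap.ext fun t => ?_
  simp only [DGModule.powParity, LinearMap.comp_apply, LinearMap.sum_apply, map_sum]
  refine Finset.sum_congr rfl fun ε _ => ?_
  split_ifs
  · exact LinearMap.congr_fun (powMap_comp_map_parityProj hf ε) t
  · exact map_zero _

theorem powMap_comp_powPerm (hf : ∀ k, ∀ x ∈ C.gr k, f x ∈ D.gr k) {a b : ℕ}
    (e : Fin a ≃ Fin b) : powMap f b ∘ₗ C.powPerm e = D.powPerm e ∘ₗ powMap f a := by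
  refine LinearMap.ext fun t => ?_
  simp only [DGModule.powPerm, LinearMap.comp_apply, LinearMap.sum_apply, map_sum]
  refine Finset.sum_congr rfl fun ε _ =>
    (LinearMap.map_smul_of_tower (powMap f b) (permSign e (par ε)) _).trans (congrArg _ ?_)
  exact (PiTensorProduct.map_reindex (fun _ => f) e _).trans <|
    congrArg (PiTensorProduct.reindex R (fun _ => D.carrier) e)
      (LinearMap.congr_fun (powMap_comp_map_parityProj hf ε) t)

theorem powMap_comp_coEndTensor (hf : ∀ k, ∀ x ∈ C.gr k, f x ∈ D.gr k) {n : ℕ} (k : Fin n → ℕ)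
    {g : ∀ i, C.carrier →ₗ[R] C.Pow (k i)} {g' : ∀ i, D.carrier →ₗ[R] D.Pow (k i)}
    (h : ∀ i, Intertwines f (g i) (g' i)) :
    powMap f _ ∘ₗ coEndTensor C k g = coEndTensor D k g' ∘ₗ powMap f n := by
  have hfactor (a b : Fin n → Fin 2) (i : Fin n) :
      powMap f (k i) ∘ₗ (C.powParity (k i) (b i) ∘ₗ g i ∘ₗ parityProj C.internal (a i)) =
        (D.powParity (k i) (b i) ∘ₗ g' i ∘ₗ parityProj D.internal (a i)) ∘ₗ f := by
    have hi : powMap f (k i) ∘ₗ g i = g' i ∘ₗ f := h i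
    rw [← LinearMap.comp_assoc, powMap_comp_powParity hf, LinearMap.comp_assoc,
      ← LinearMap.comp_assoc _ (g i) (powMap f (k i)), hi, LinearMap.comp_assoc,
      comp_parityProj C.internal D.internal hf]
    rfl
  refine LinearMap.ext fun t => ?_
  simp only [coEndTensor, sum_apply, LinearMap.comp_apply, LinearMap.sum_apply, map_sum]
  refine Finset.sum_congr rfl fun a _ => Finset.sum_congr rfl fun b _ =>
    (LinearMap.map_smul_of_tower (powMap f _) (_ : ℤˣ) _).trans (congrArg _ ?_)
  refine (LinearMap.congr_fun (powMap_comp_flatten f k) _).trans (congrArg (flatten D.carrier k) ?_)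
  exact LinearMap.congr_fun (piTensorProduct_map_comp_map_comm (hfactor a b)) t

end TensorPower

section CoEnd

variable {C : DGModule.{u, v} R} {D : DGModule.{u, w} R} {f : C.carrier →ₗ[R] D.carrier}

theorem Intertwines.coEnd_d (hf : ∀ k, ∀ x ∈ C.gr k, f x ∈ D.gr k) (hd : f ∘ₗ C.d = D.d ∘ₗ f)
    {n : ℕ} {g : C.carrier →ₗ[R] C.Pow n} {g' : D.carrier →ₗ[R] D.Pow n}
    (h : Intertwines f g g') : Intertwines f ((coEnd C).d n g) ((coEnd D).d n g') := by
  have h (x : C.carrier) : powMap f n (g x) = g' (f x) := LinearMap.congr_fun h x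
  have hd (x : C.carrier) : f (C.d x) = D.d (f x) := LinearMap.congr_fun hd x
  have hpowD (t : C.Pow n) : powMap f n (C.powD n t) = D.powD n (powMap f n t) :=
    LinearMap.congr_fun (powMap_comp_powD hf (LinearMap.ext hd) n) t
  have hpowSign (t : C.Pow n) : powMap f n (C.powSign n t) = D.powSign n (powMap f n t) :=
    LinearMap.congr_fun (powMap_comp_powSign hf n) t
  have hsign (x : C.carrier) : f (signInv C.internal x) = signInv D.internal (f x) :=
    LinearMap.congr_fun (comp_signInv _ _ hf) x
  refine LinearMap.ext fun x => ?_
  calc powMap f n (g (C.d x) - C.powD n (C.powSign n (g (signInv C.internal x))))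
      = g' (D.d (f x)) - D.powD n (D.powSign n (g' (signInv D.internal (f x)))) := by
        rw [map_sub, h, hd, hpowD, hpowSign, h, hsign]

theorem Intertwines.coEnd_act (hf : ∀ k, ∀ x ∈ C.gr k, f x ∈ D.gr k) {a b : ℕ}
    (e : Fin a ≃ Fin b) {g : C.carrier →ₗ[R] C.Pow b} {g' : D.carrier →ₗ[R] D.Pow b}
    (h : Intertwines f g g') : Intertwines f ((coEnd C).act e g) ((coEnd D).act e g') := by
  calc powMap f a ∘ₗ C.powPerm e.symm ∘ₗ g
      = D.powPerm e.symm ∘ₗ powMap f b ∘ₗ g := by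
        rw [← LinearMap.comp_assoc, powMap_comp_powPerm hf, LinearMap.comp_assoc]
    _ = (D.powPerm e.symm ∘ₗ g') ∘ₗ f := congrArg (D.powPerm e.symm ∘ₗ ·) h

theorem intertwines_coEnd_one (f : C.carrier →ₗ[R] D.carrier) :
    Intertwines f (coEnd C).one (coEnd D).one := by
  refine LinearMap.ext fun x => ?_
  calc powMap f 1 ((PiTensorProduct.subsingletonEquiv (s := fun _ => C.carrier) 0).symm x)
      = (PiTensorProduct.subsingletonEquiv (s := fun _ => D.carrier) 0).symm (f x) := by
        rw [PiTensorProduct.subsingletonEquiv_symm_apply',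
          PiTensorProduct.subsingletonEquiv_symm_apply', PiTensorProduct.map_tprod]

theorem Intertwines.coEnd_comp (hf : ∀ k, ∀ x ∈ C.gr k, f x ∈ D.gr k) {n : ℕ} (k : Fin n → ℕ)
    {g : C.carrier →ₗ[R] C.Pow n} {g' : D.carrier →ₗ[R] D.Pow n}
    {p : ∀ i, C.carrier →ₗ[R] C.Pow (k i)} {p' : ∀ i, D.carrier →ₗ[R] D.Pow (k i)}
    (h : Intertwines f g g') (hp : ∀ i, Intertwines f (p i) (p' i)) :
    Intertwines f ((coEnd C).comp k g p) ((coEnd D).comp k g' p') := by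
  calc powMap f _ ∘ₗ coEndTensor C k p ∘ₗ g
      = coEndTensor D k p' ∘ₗ powMap f n ∘ₗ g := by
        rw [← LinearMap.comp_assoc, powMap_comp_coEndTensor hf k hp, LinearMap.comp_assoc]
    _ = (coEndTensor D k p' ∘ₗ g') ∘ₗ f := congrArg (coEndTensor D k p' ∘ₗ ·) h

end CoEnd

section Multidegree

variable (C : DGModule.{u, v} R)

/-- The projection of the tensor power `C ⊗ ⋯ ⊗ C` onto its part of multidegree `q`, as an
endomorphism. -/
noncomputable def multidegreeProj {n : ℕ} (q : Fin n → ℤ) : C.Pow n →ₗ[R] C.Pow n :=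
  PiTensorProduct.map fun i => degreeProj C.internal (q i)

theorem multidegreeProj_mem {n : ℕ} (q : Fin n → ℤ) (t : C.Pow n) :
    multidegreeProj C q t ∈ C.powGr n (∑ i, q i) := by
  induction t using PiTensorProduct.induction_on with
  | smul_tprod r x =>
    rw [map_smul]
    exact Submodule.smul_mem _ _ <| Submodule.subset_span
      ⟨fun i => degreeProj C.internal (q i) (x i), q, fun i => degreeProj_mem _ _ _, rfl,
        PiTensorProduct.map_tprod _ _⟩
  | add s t hs ht => exact map_add (multidegreeProj C q) s t ▸ add_mem hs ht

theorem multidegreeProj_eq_zero {n : ℕ} {q : Fin n → ℤ} {m : ℤ} (hq : ∑ i, q i ≠ m) {t : C.Pow n}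
    (ht : t ∈ C.powGr n m) : multidegreeProj C q t = 0 := by
  suffices hle : C.powGr n m ≤ LinearMap.ker (multidegreeProj C q) from hle ht
  refine Submodule.span_le.2 ?_
  rintro _ ⟨x, p, hx, hp, rfl⟩
  obtain ⟨i, hi⟩ : ∃ i, p i ≠ q i := Function.ne_iff.1 fun hpq => hq (hpq ▸ hp)
  refine (PiTensorProduct.map_tprod _ _).trans (MultilinearMap.map_coord_zero _ i ?_)
  rw [degreeProj_of_mem _ _ (hx i), if_neg hi]

theorem exists_sum_multidegreeProj {n : ℕ} (t : C.Pow n) :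
    ∃ s : Finset (Fin n → ℤ), ∀ s', s ⊆ s' → ∑ q ∈ s', multidegreeProj C q t = t := by
  classical
  induction t using PiTensorProduct.induction_on with
  | smul_tprod r x =>
    choose F hF hF' using fun i => exists_sum_degreeProj C.internal (x i)
    have htprod (q : Fin n → ℤ) : multidegreeProj C q (PiTensorProduct.tprod R x) =
        PiTensorProduct.tprod R fun i => degreeProj C.internal (q i) (x i) :=
      PiTensorProduct.map_tprod _ _
    refine ⟨Fintype.piFinset F, fun s' hs' => ?_⟩
    simp only [map_smul, htprod]
    rw [← Finset.smul_sum, ← Finset.sum_subset hs', ← MultilinearMap.map_sum_finset _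
      (fun i k => degreeProj C.internal k (x i)), funext hF]
    intro q _ hq
    obtain ⟨i, hi⟩ : ∃ i, q i ∉ F i := by simpa using hq
    exact MultilinearMap.map_coord_zero _ i (hF' i _ hi)
  | add a b ha hb =>
    obtain ⟨s, hs⟩ := ha
    obtain ⟨t, ht⟩ := hb
    refine ⟨s ∪ t, fun s' h => ?_⟩
    simp only [map_add]
    rw [Finset.sum_add_distrib, hs _ (Finset.union_subset_left h),
      ht _ (Finset.union_subset_right h)]

variable {C} {D : DGModule.{u, w} R} {f : C.carrier →ₗ[R] D.carrier}

theorem mem_powGr_of_powMap_mem (hf : ∀ k, ∀ x ∈ C.gr k, f x ∈ D.gr k) {n : ℕ}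
    (hinj : Function.Injective (powMap f n)) {m : ℤ} {t : C.Pow n}
    (ht : powMap f n t ∈ D.powGr n m) : t ∈ C.powGr n m := by
  obtain ⟨s, hs⟩ := exists_sum_multidegreeProj C t
  rw [← hs s subset_rfl]
  refine Submodule.sum_mem _ fun q _ => ?_
  by_cases hq : ∑ i, q i = m
  · exact hq ▸ multidegreeProj_mem C q t
  · have hcomm : powMap f n (multidegreeProj C q t) = multidegreeProj D q (powMap f n t) :=
      LinearMap.congr_fun (piTensorProduct_map_comp_map_comm
        fun i => comp_degreeProj C.internal D.internal hf (q i)) t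
    have hzero : multidegreeProj C q t = 0 :=
      hinj <| hcomm.trans <| (multidegreeProj_eq_zero D hq ht).trans (map_zero _).symm
    exact hzero ▸ zero_mem _

end Multidegree

section SubCoalgebra

theorem mem_coEnd_gr_iff {C : DGModule.{u, v} R} {n : ℕ} {k : ℤ}
    {g : C.carrier →ₗ[R] C.Pow n} :
    g ∈ (coEnd C).gr n k ↔ ∀ j, ∀ x ∈ C.gr j, g x ∈ C.powGr n (j + k) :=
  Submodule.mem_iInf _

/-- The structure of a `V`-coalgebra on `C` that cooperations `app n v` lifting those of `D` along
`f` define. All axioms are inherited from `D`, since `f ⊗ ⋯ ⊗ f` can be cancelled. -/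
def OperadHom.ofIntertwines {V : OperadData.{u, v} R} {C : DGModule.{u, w} R}
    {D : DGModule.{u, u'} R} (str : OperadHom V (coEnd D)) {f : C.carrier →ₗ[R] D.carrier}
    (hf : ∀ k, ∀ x ∈ C.gr k, f x ∈ D.gr k) (hd : f ∘ₗ C.d = D.d ∘ₗ f)
    (hinj : ∀ n, Function.Injective (powMap f n))
    (app : ∀ n, V.obj n →ₗ[R] C.carrier →ₗ[R] C.Pow n)
    (happ : ∀ n v, Intertwines f (app n v) (str.app n v)) : OperadHom V (coEnd C) where
  app := app
  app_mem n k v hv := mem_coEnd_gr_iff.2 fun j x hx => by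
    refine mem_powGr_of_powMap_mem hf (hinj n) ?_
    let g : D.carrier →ₗ[R] D.Pow n := str.app n v
    have hfx : powMap f n (app n v x) = g (f x) := LinearMap.congr_fun (happ n v) x
    exact hfx ▸ mem_coEnd_gr_iff.1 (str.app_mem n k v hv) j (f x) (hf j x hx)
  app_d n v := Intertwines.left_unique (hinj n) (happ _ _)
    (str.app_d n v ▸ (happ n v).coEnd_d hf hd)
  app_act {a b} e v := Intertwines.left_unique (hinj a) (happ _ _)
    (str.app_act e v ▸ (happ b v).coEnd_act hf e)
  app_one := Intertwines.left_unique (hinj 1) (happ _ _) (str.app_one ▸ intertwines_coEnd_one f)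
  app_comp k v y := Intertwines.left_unique (hinj _) (happ _ _)
    (str.app_comp k v y ▸ (happ _ v).coEnd_comp hf k fun i => happ _ (y i))

/-- The inclusion of a subcomplex, as a linear map on the underlying module of the chain complex
`S.toDGModule`. -/
def Subcomplex.subtype {C : DGModule.{u, v} R} (S : Subcomplex C) :
    S.toDGModule.carrier →ₗ[R] C.carrier :=
  S.toSubmodule.subtype

theorem Subcomplex.subtype_mem {C : DGModule.{u, v} R} (S : Subcomplex C) (k : ℤ)
    (x : S.toDGModule.carrier) (hx : x ∈ S.toDGModule.gr k) : S.subtype x ∈ C.gr k :=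
  hx

theorem Subcomplex.subtype_comp_d {C : DGModule.{u, v} R} (S : Subcomplex C) :
    S.subtype ∘ₗ S.toDGModule.d = C.d ∘ₗ S.subtype :=
  rfl

theorem Subcomplex.powMap_subtype_injective {C : DGModule.{u, v} R} (S : Subcomplex C)
    [Module.Flat R C.carrier] [Module.Flat R S.toSubmodule] (n : ℕ) :
    Function.Injective (powMap S.subtype n) :=
  have : Module.Flat R S.toDGModule.carrier := ‹Module.Flat R S.toSubmodule›
  piTensorProduct_map_injective_of_flat fun _ => S.toSubmodule.injective_subtype

variable {V : Operad.{u, v} R} {C : Coalgebra.{u, v, w} V}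

/-- The subcomplex `S` is carried into the image of `S ⊗ ⋯ ⊗ S` by all cooperations of `C`. -/
def Coalgebra.IsStable (C : Coalgebra.{u, v, w} V) (S : Subcomplex C.cx) : Prop :=
  ∀ n (v : V.obj n) (x : S.toDGModule.carrier),
    C.cop n v (S.subtype x) ∈ LinearMap.range (powMap S.subtype n)

/-- The restriction of the cooperations of arity `n` to a stable subcomplex. -/
noncomputable def Coalgebra.IsStable.cop {S : Subcomplex C.cx} (hS : C.IsStable S) {n : ℕ}
    (hinj : Function.Injective (powMap S.subtype n)) :
    V.obj n →ₗ[R] S.toDGModule.carrier →ₗ[R] S.toDGModule.Pow n :=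
  LinearMap.codRestrict₂ ((C.cop n).compl₂ S.subtype) (powMap S.subtype n) hinj (hS n)

theorem Coalgebra.IsStable.intertwines_cop {S : Subcomplex C.cx} (hS : C.IsStable S) {n : ℕ}
    (hinj : Function.Injective (powMap S.subtype n)) (v : V.obj n) :
    Intertwines S.subtype (hS.cop hinj v) (C.cop n v) :=
  LinearMap.ext fun x => LinearMap.codRestrict₂_apply _ _ hinj (hS n) v x

/-- A stable subcomplex whose tensor powers embed into those of `C`, as a sub-coalgebra. -/
noncomputable def Coalgebra.IsStable.subCoalgebra {S : Subcomplex C.cx} (hS : C.IsStable S)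
    (hinj : ∀ n, Function.Injective (powMap S.subtype n)) : SubCoalgebra C where
  sub := S
  str := C.str.ofIntertwines S.subtype_mem S.subtype_comp_d hinj (fun n => hS.cop (hinj n))
    fun n v => hS.intertwines_cop (hinj n) v
  incl :=
    { map_mem := S.subtype_mem
      map_d := fun _ => rfl
      map_str := fun n v => LinearMap.congr_fun (hS.intertwines_cop (hinj n) v) }

theorem SubCoalgebra.isCoalgebraHom_inclusion {A B : SubCoalgebra C}
    (hinj : ∀ n, Function.Injective (powMap B.sub.subtype n))
    (h : A.toSubmodule ≤ B.toSubmodule) :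
    IsCoalgebraHom A.toCoalgebra B.toCoalgebra (Submodule.inclusion h) where
  map_mem _ _ hx := hx
  map_d _ := rfl
  map_str n v x := by
    let i : A.toCoalgebra.cx.carrier →ₗ[R] B.toCoalgebra.cx.carrier := Submodule.inclusion h
    refine hinj n ?_
    calc powMap B.sub.subtype n (powMap i n (A.toCoalgebra.cop n v x))
        = powMap A.sub.subtype n (A.toCoalgebra.cop n v x) :=
          (LinearMap.congr_fun (PiTensorProduct.map_comp _ _) _).symm
      _ = C.cop n v (A.sub.subtype x) := A.incl.map_str n v x
      _ = powMap B.sub.subtype n (B.toCoalgebra.cop n v (i x)) :=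
          (B.incl.map_str n v (i x)).symm

theorem isCoalgebraHom_of_forall_restrict {D : Coalgebra.{u, v, u'} V}
    {ψ : C.cx.carrier →ₗ[R] D.cx.carrier}
    (h : ∀ x, ∃ A : SubCoalgebra C, x ∈ A.toSubmodule ∧
      IsCoalgebraHom A.toCoalgebra D (ψ ∘ₗ A.toSubmodule.subtype)) : IsCoalgebraHom C D ψ where
  map_mem k x hx := by
    obtain ⟨A, hxA, hA⟩ := h x
    exact hA.map_mem k ⟨x, hxA⟩ hx
  map_d x := by
    obtain ⟨A, hxA, hA⟩ := h x
    exact hA.map_d ⟨x, hxA⟩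
  map_str n v x := by
    obtain ⟨A, hxA, hA⟩ := h x
    calc powMap ψ n (C.cop n v x)
        = powMap ψ n (powMap A.sub.subtype n (A.toCoalgebra.cop n v ⟨x, hxA⟩)) :=
          congrArg _ (A.incl.map_str n v ⟨x, hxA⟩).symm
      _ = powMap (ψ ∘ₗ A.sub.subtype) n (A.toCoalgebra.cop n v ⟨x, hxA⟩) :=
          (LinearMap.congr_fun (PiTensorProduct.map_comp _ _) _).symm
      _ = D.cop n v (ψ x) := hA.map_str n v ⟨x, hxA⟩

end SubCoalgebra

section Countable

theorem exists_finite_forall_mem_range_map_subtype {M : Type v} [AddCommGroup M] [Module R M]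
    {ι : Type*} [Finite ι] (t : ⨂[R] _ : ι, M) :
    ∃ s : Set M, s.Finite ∧ ∀ N : Submodule R M, s ⊆ N →
      t ∈ LinearMap.range (PiTensorProduct.map fun _ : ι => N.subtype) := by
  induction t using PiTensorProduct.induction_on with
  | smul_tprod r x =>
    exact ⟨Set.range x, Set.finite_range x, fun N hN => Submodule.smul_mem _ _
      ⟨PiTensorProduct.tprod R fun i => ⟨x i, hN ⟨i, rfl⟩⟩, PiTensorProduct.map_tprod _ _⟩⟩
  | add a b ha hb =>
    obtain ⟨s, hs, hsN⟩ := ha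
    obtain ⟨t, ht, htN⟩ := hb
    exact ⟨s ∪ t, hs.union ht, fun N hN => add_mem
      (hsN N (Set.subset_union_left.trans hN)) (htN N (Set.subset_union_right.trans hN))⟩

variable [Countable R]

theorem countable_span {M : Type*} [AddCommGroup M] [Module R M] {s : Set M} (hs : s.Countable) :
    Countable (Submodule.span R s) := by
  have := hs.to_subtype
  simpa only [Subtype.range_coe] using
    (inferInstance : Countable (Submodule.span R (Set.range ((↑) : s → M))))

theorem flat_of_forall_countable_flat {M : Type v} [AddCommGroup M] [Module R M]
    (h : ∀ N : Submodule R M, Countable N → Module.Flat R N) : Module.Flat R M :=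
  flat_of_forall_fg_flat fun N hN =>
    have : Module.Finite R N := Module.Finite.iff_fg.2 hN
    h N (Finsupp.Countable.of_moduleFinite (R := R))

theorem exists_countable_submodule_closed {M : Type v} [AddCommGroup M] [Module R M]
    {G : M → Set M} (hG : ∀ x, (G x).Countable) {s : Set M} (hs : s.Countable) :
    ∃ N : Submodule R M, Countable N ∧ s ⊆ N ∧ ∀ x ∈ N, G x ⊆ N := by
  let enlarge (N : Submodule R M) : Submodule R M := Submodule.span R (N ∪ ⋃ x ∈ N, G x)
  let N (i : ℕ) : Submodule R M := enlarge^[i] (Submodule.span R s)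
  have hsucc (i : ℕ) : N (i + 1) = enlarge (N i) := Function.iterate_succ_apply' _ _ _
  have hcount (i : ℕ) : Countable (N i) := by
    induction i with
    | zero => exact countable_span hs
    | succ i ih =>
      rw [hsucc]
      exact countable_span (ih.to_set.union (ih.to_set.biUnion fun x _ => hG x))
  have hmono : Monotone N := monotone_nat_of_le_succ fun i x hx =>
    hsucc i ▸ Submodule.subset_span (Or.inl hx)
  have hunion : ((⨆ i, N i : Submodule R M) : Set M) = ⋃ i, (N i : Set M) :=
    Submodule.coe_iSup_of_directed N hmono.directed_le
  refine ⟨⨆ i, N i, ?_, ?_, fun x hx y hy => ?_⟩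
  · have hcountable : (⋃ i, (N i : Set M)).Countable :=
      Set.countable_iUnion fun i => (hcount i).to_set
    exact (hunion ▸ hcountable).to_subtype
  · exact Submodule.subset_span.trans (le_iSup N 0 : N 0 ≤ _)
  · obtain ⟨i, hi⟩ := (Submodule.mem_iSup_of_directed N hmono.directed_le).1 hx
    exact Submodule.mem_iSup_of_mem (i + 1)
      (hsucc i ▸ Submodule.subset_span (Or.inr (Set.mem_biUnion hi hy)))

theorem Operad.Admissible.countable {V : Operad.{u, v} R} (hV : V.Admissible) (n : ℕ) :
    Countable (V.obj n) := by
  have (k : ℤ) : Countable (V.gr n k) :=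
    have : Module.Finite R (V.gr n k) := Module.Finite.iff_fg.2 (hV.finite_type n k)
    Finsupp.Countable.of_moduleFinite (R := R)
  have : Countable (DirectSum ℤ fun k => V.gr n k) :=
    inferInstanceAs (Countable (Π₀ k, V.gr n k))
  exact (V.internal n).surjective.countable

variable {V : Operad.{u, v} R} {C : Coalgebra.{u, v, w} V}

theorem exists_countable_isStable (hV : ∀ n, Countable (V.obj n)) {s : Set C.cx.carrier}
    (hs : s.Countable) :
    ∃ S : Subcomplex C.cx, C.IsStable S ∧ Countable S.toSubmodule ∧ s ⊆ S.toSubmodule := by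
  choose factors hfinite hfactors using
    fun n => exists_finite_forall_mem_range_map_subtype (R := R) (M := C.cx.carrier) (ι := Fin n)
  let G (x : C.cx.carrier) : Set C.cx.carrier :=
    {C.cx.d x} ∪ Set.range (fun k => degreeProj C.cx.internal k x) ∪
      ⋃ n, ⋃ v : V.obj n, factors n (C.cop n v x)
  have hG (x : C.cx.carrier) : (G x).Countable :=
    ((Set.countable_singleton _).union (Set.countable_range _)).union <|
      Set.countable_iUnion fun n => Set.countable_iUnion fun v => (hfinite n _).countable
  obtain ⟨N, hN, hsN, hclosed⟩ := exists_countable_submodule_closed (R := R) hG hs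
  let S : Subcomplex C.cx :=
    { toSubmodule := N
      graded := le_iSup_inf_of_degreeProj_mem C.cx.internal fun k x hx =>
        hclosed x hx (Or.inl (Or.inr ⟨k, rfl⟩))
      d_mem := fun x hx => hclosed x hx (Or.inl (Or.inl rfl)) }
  refine ⟨S, fun n v x => hfactors n _ N fun y hy => ?_, hN, hsN⟩
  exact hclosed x.1 x.2 (Or.inr (Set.mem_iUnion₂.2 ⟨n, v, hy⟩))

theorem powMap_subtype_injective_of_forall_countable_flat
    (hC : ∀ N : Submodule R C.cx.carrier, Countable N → Module.Flat R N)
    (S : Subcomplex C.cx) (hS : Countable S.toSubmodule) (n : ℕ) :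
    Function.Injective (powMap S.subtype n) :=
  have := flat_of_forall_countable_flat hC
  have := hC S.toSubmodule hS
  S.powMap_subtype_injective n

theorem exists_countable_subCoalgebra (hV : ∀ n, Countable (V.obj n))
    (hC : ∀ N : Submodule R C.cx.carrier, Countable N → Module.Flat R N)
    {s : Set C.cx.carrier} (hs : s.Countable) :
    ∃ A : SubCoalgebra C, Countable A.toSubmodule ∧ s ⊆ A.toSubmodule :=
  let ⟨S, hS, hcount, hsub⟩ := exists_countable_isStable hV hs
  ⟨hS.subCoalgebra (powMap_subtype_injective_of_forall_countable_flat hC S hcount), hcount, hsub⟩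

end Countable

section Colimit

theorem existsUnique_linearMap_of_directed {M : Type v} {N : Type w} [AddCommGroup M] [Module R M]
    [AddCommGroup N] [Module R N] {ι : Type*} {S : ι → Submodule R M}
    (hdir : Directed (· ≤ ·) S) (hcov : ∀ x, ∃ i, x ∈ S i) {φ : ∀ i, S i →ₗ[R] N}
    (hφ : ∀ i j (h : S i ≤ S j), φ j ∘ₗ Submodule.inclusion h = φ i) :
    ∃! ψ : M →ₗ[R] N, ∀ i, ψ ∘ₗ (S i).subtype = φ i := by
  choose c hc using hcov
  have hindep (i : ι) (x : M) (hx : x ∈ S i) : φ (c x) ⟨x, hc x⟩ = φ i ⟨x, hx⟩ := by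
    obtain ⟨k, hck, hik⟩ := hdir (c x) i
    rw [← hφ _ _ hck, ← hφ _ _ hik]
    rfl
  let ψ : M →ₗ[R] N :=
    { toFun x := φ (c x) ⟨x, hc x⟩
      map_add' x y := by
        obtain ⟨k, hxk, hyk⟩ := hdir (c x) (c y)
        rw [hindep k _ (hxk (hc x)), hindep k _ (hyk (hc y)),
          hindep k _ (add_mem (hxk (hc x)) (hyk (hc y))), ← map_add]
        rfl
      map_smul' r x := by
        rw [hindep (c x) _ (Submodule.smul_mem _ r (hc x)), RingHom.id_apply, ← map_smul]
        rfl }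
  refine ⟨ψ, fun i => LinearMap.ext fun x => hindep i x.1 x.2, fun ψ' hψ' => ?_⟩
  exact LinearMap.ext fun x => LinearMap.congr_fun (hψ' (c x)) ⟨x, hc x⟩

end Colimit

end DGOperad

theorem theoremB6_general {R : Type u} [CommRing R] [Countable R]
    (V : DGOperad.Operad.{u, v} R) (hV : ∀ n, Countable (V.obj n))
    (C : DGOperad.Coalgebra.{u, v, w} V)
    (hC : ∀ N : Submodule R C.cx.carrier, Countable N → Module.Flat R N) :
    (∀ A B : DGOperad.SubCoalgebra C, Countable A.toSubmodule → Countable B.toSubmodule →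
      ∃ E : DGOperad.SubCoalgebra C, Countable E.toSubmodule ∧
        A.toSubmodule ≤ E.toSubmodule ∧ B.toSubmodule ≤ E.toSubmodule) ∧
    (∀ A B : DGOperad.SubCoalgebra C, Countable A.toSubmodule → Countable B.toSubmodule →
      ∀ h : A.toSubmodule ≤ B.toSubmodule,
        DGOperad.IsCoalgebraHom A.toCoalgebra B.toCoalgebra (Submodule.inclusion h)) ∧
    (∀ x : C.cx.carrier, ∃ A : DGOperad.SubCoalgebra C,
      Countable A.toSubmodule ∧ x ∈ A.toSubmodule) ∧
    (∀ (D : DGOperad.Coalgebra.{u, v, u'} V)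
      (φ : ∀ A : DGOperad.SubCoalgebra C, Countable A.toSubmodule →
        A.toSubmodule →ₗ[R] D.cx.carrier),
      (∀ A hA, DGOperad.IsCoalgebraHom A.toCoalgebra D (φ A hA)) →
      (∀ A B hA hB (h : A.toSubmodule ≤ B.toSubmodule),
        φ B hB ∘ₗ Submodule.inclusion h = φ A hA) →
      ∃! ψ : C.cx.carrier →ₗ[R] D.cx.carrier, DGOperad.IsCoalgebraHom C D ψ ∧
        ∀ A hA, ψ ∘ₗ A.toSubmodule.subtype = φ A hA) := by
  have henlarge {s : Set C.cx.carrier} (hs : s.Countable) :=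
    DGOperad.exists_countable_subCoalgebra hV hC hs
  have hdir (A B : DGOperad.SubCoalgebra C) (hA : Countable A.toSubmodule)
      (hB : Countable B.toSubmodule) : ∃ E : DGOperad.SubCoalgebra C, Countable E.toSubmodule ∧
        A.toSubmodule ≤ E.toSubmodule ∧ B.toSubmodule ≤ E.toSubmodule :=
    let ⟨E, hE, hsub⟩ := henlarge (hA.to_set.union hB.to_set)
    ⟨E, hE, Set.union_subset_iff.1 hsub⟩
  have hcov (x : C.cx.carrier) :
      ∃ A : DGOperad.SubCoalgebra C, Countable A.toSubmodule ∧ x ∈ A.toSubmodule :=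
    let ⟨A, hA, hsub⟩ := henlarge (Set.countable_singleton x)
    ⟨A, hA, hsub rfl⟩
  refine ⟨hdir, fun A B _ hB h => DGOperad.SubCoalgebra.isCoalgebraHom_inclusion
    (DGOperad.powMap_subtype_injective_of_forall_countable_flat hC B.sub hB) h,
    hcov, fun D φ hφ hcomp => ?_⟩
  obtain ⟨ψ, hψ, huniq⟩ := DGOperad.existsUnique_linearMap_of_directed
    (S := fun A : {A : DGOperad.SubCoalgebra C // Countable A.toSubmodule} => A.1.toSubmodule)
    (fun A B => let ⟨E, hE, h⟩ := hdir A.1 B.1 A.2 B.2; ⟨⟨E, hE⟩, h⟩)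
    (fun x => let ⟨A, hA, hx⟩ := hcov x; ⟨⟨A, hA⟩, hx⟩)
    (φ := fun A => φ A.1 A.2) fun A B h => hcomp A.1 B.1 A.2 B.2 h
  have hψhom : DGOperad.IsCoalgebraHom C D ψ :=
    DGOperad.isCoalgebraHom_of_forall_restrict fun x =>
      let ⟨A, hA, hx⟩ := hcov x
      ⟨A, hx, (hψ ⟨A, hA⟩).symm ▸ hφ A hA⟩
  exact ⟨ψ, ⟨hψhom, fun A hA => hψ ⟨A, hA⟩⟩, fun ψ' h => huniq ψ' fun A => h.2 A.1 A.2⟩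

theorem theoremB6 {R : Type u} [CommRing R] [Countable R]
    (hR : IsField R ∨ Nonempty (R ≃+* ℤ))
    (V : DGOperad.Operad.{u, v} R) (hV : V.Admissible)
    (C : DGOperad.Coalgebra.{u, v, w} V) (hC : DGOperad.NearlyFree R C.cx.carrier) :
    (∀ A B : DGOperad.SubCoalgebra C, Countable A.toSubmodule → Countable B.toSubmodule →
      ∃ E : DGOperad.SubCoalgebra C, Countable E.toSubmodule ∧
        A.toSubmodule ≤ E.toSubmodule ∧ B.toSubmodule ≤ E.toSubmodule) ∧
    (∀ A B : DGOperad.SubCoalgebra C, Countable A.toSubmodule → Countable B.toSubmodule →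
      ∀ h : A.toSubmodule ≤ B.toSubmodule,
        DGOperad.IsCoalgebraHom A.toCoalgebra B.toCoalgebra (Submodule.inclusion h)) ∧
    (∀ x : C.cx.carrier, ∃ A : DGOperad.SubCoalgebra C,
      Countable A.toSubmodule ∧ x ∈ A.toSubmodule) ∧
    (∀ (D : DGOperad.Coalgebra.{u, v, u'} V)
      (φ : ∀ A : DGOperad.SubCoalgebra C, Countable A.toSubmodule →
        A.toSubmodule →ₗ[R] D.cx.carrier),
      (∀ A hA, DGOperad.IsCoalgebraHom A.toCoalgebra D (φ A hA)) →
      (∀ A B hA hB (h : A.toSubmodule ≤ B.toSubmodule),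
        φ B hB ∘ₗ Submodule.inclusion h = φ A hA) →
      ∃! ψ : C.cx.carrier →ₗ[R] D.cx.carrier, DGOperad.IsCoalgebraHom C D ψ ∧
        ∀ A hA, ψ ∘ₗ A.toSubmodule.subtype = φ A hA) := by
  refine theoremB6_general V hV.countable C fun N hN => ?_
  have := hC N hN
  infer_instance
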